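/- Let $\mathcal X$ be a topological space with a $\sigma$-finite Borel measure $\omega$ of full support (every non-empty open set has positive measure), and let $k:\mathcal X\times\mathcal X\to\mathbb R$ be a continuous, symmetric, positive semi-definite kernel with $\int_{\mathcal X}k(x,x)\,d\omega(x)<\infty$. Let $\boldsymbol\Sigma f(x)=\int_{\mathcal X}k(x,y)f(y)\,d\omega(y)$ be its integral operator on $L^2(\omega)$. For $m\in\mathbb N^*=\{1,2,\dots\}$ let $e_m$ be the $m$-th eigenfunction of $\boldsymbol\Sigma$ and $\sigma_m$ the corresponding eigenvalue. That is, $(e_m)_{m\ge1}$ is an orthonormal sequence in $L^2(\omega)$ of functions with $\boldsymbol\Sigma e_m(x)=\sigma_m e_m(x)$ for every $x\in\mathcal X$, the sequence $(\sigma_m)$ is non-increasing, and every nonzero eigenvalue of $\boldsymbol\Sigma$ is listed with its multiplicity (an eigenfunction with nonzero eigenvalue that is orthogonal to all $e_m$ vanishes a.e.). For instance, $(e_m)$ may be an orthonormal basis of $L^2(\omega)$ consisting of eigenfunctions. Let $N\in\mathbb N^*$, let $\mathcal U_N=\{U\subset\mathbb N^*:|U|=N\}$, and for finite $U\subset\mathbb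 N^*$ put $\mathfrak K_U(x,y)=\sum_{u\in U}e_u(x)e_u(y)$. Then: 1. For every $U\in\mathcal U_N$, the function $(x_1,\dots,x_N)\mapsto\frac1{N!}\det(\mathfrak K_U(x_i,x_j))_{1\le i,j\le N}$ (the projection DPP with marginal kernel $\mathfrak K_U$) is a probability density with respect to $\omega^{\otimes N}$. 2. For every $(x_1,\dots,x_N)\in\mathcal X^N$, $$\det(k(x_i,x_j))_{1\le i,j\le N}=\sum_{U\in\mathcal U_N}\Big(\prod_{u\in U}\sigma_u\Big)\det(\mathfrak K_U(x_i,x_j))_{1\le i,j\le N},$$ with an (unconditionally) convergent sum. 3. The function $(x_1,\dots,x_N)\mapsto\det(k(x_i,x_j))$ is $\omega^{\otimes N}$-integrable, $\sum_{U\in\mathcal U_N}\prod_{u\in U}\sigma_u$ converges, and $$Z_N(k):=\int_{\mathcal X^N}\det(k(x_i,x_j))\,d\omega(x_1)\cdots d\omega(x_N)=N!\sum_{U\in\mathcal U_N}\prod_{u\in U}\sigma_u .$$ 4. $Z_N(k)>0$ if and only if $\sigma_N>0$. In that case the continuous volume-sampling density $f_{\mathrm{VS}}(x_1,\dots,x_N)=Z_N(k)^{-1}\det(k(x_i,x_j))$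 is a probability density with respect to $\omega^{\otimes N}$, and for every $(x_1,\dots,x_N)\in\mathcal X^N$ $$f_{\mathrm{VS}}(x_1,\dots,x_N)=\frac1{Z_N(k)}\sum_{U\in\mathcal U_N}\Big(\prod_{u\in U}\sigma_u\Big)\det(\mathfrak K_U(x_i,x_j))_{1\le i,j\le N}.$$ -/

import Mathlib

open MeasureTheory

namespace VolumeSampling

/-- The integral operator `Σ f (x) = ∫ k(x, y) f(y) dω(y)`, as a function defined at every point. -/
noncomputable def integralOperator {X : Type*} [MeasurableSpace X] (k : X → X → ℝ)
    (ω : Measure X) (f : X → ℝ) (x : X) : ℝ :=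
  ∫ y, k x y * f y ∂ω

/-- `σ m` and `e m` are the `m`-th eigenvalue and the `m`-th normalized eigenfunction of the
integral operator of `k` on `L²(ω)`: the `e m` form an orthonormal sequence of eigenfunctions
(taken as pointwise defined functions), the eigenvalues are non-increasing, and all nonzero
eigenvalues are listed, with multiplicity. -/
structure IsEigensystem {X : Type*} [MeasurableSpace X] (k : X → X → ℝ) (ω : Measure X)
    (σ : ℕ+ → ℝ) (e : ℕ+ → X → ℝ) : Prop where
  memLp : ∀ m, MemLp (e m) 2 ω
  orthonormal : ∀ m n, ∫ x, e m x * e n x ∂ω = if m = n then 1 else 0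
  eigen : ∀ m x, integralOperator k ω (e m) x = σ m * e m x
  antitone : Antitone σ
  exhaustive : ∀ (f : X → ℝ) (c : ℝ), MemLp f 2 ω → c ≠ 0 →
    (∀ᵐ x ∂ω, integralOperator k ω f x = c * f x) →
    (∀ m, ∫ x, f x * e m x ∂ω = 0) → ∀ᵐ x ∂ω, f x = 0

/-- The determinant of the matrix `(k (x i) (x j))` over a configuration `x` of `N` points. -/
noncomputable def kernelDet {X : Type*} (k : X → X → ℝ) {N : ℕ} (x : Fin N → X) : ℝ :=
  Matrix.det (Matrix.of fun i j => k (x i) (x j))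

/-- The projection kernel `𝔎_U (x, y) = ∑ u ∈ U, e_u (x) e_u (y)`. -/
noncomputable def projectionKernel {X : Type*} (e : ℕ+ → X → ℝ) (U : Finset ℕ+) (x y : X) : ℝ :=
  ∑ u ∈ U, e u x * e u y

/-- The product measure on configurations of `N` points. -/
noncomputable def configMeasure {X : Type*} [MeasurableSpace X] (ω : Measure X) (N : ℕ) :
    Measure (Fin N → X) :=
  Measure.pi fun _ => ω

/-- `f` is a probability density with respect to the product measure. -/
def IsDensity {X : Type*} [MeasurableSpace X] (ω : Measure X) {N : ℕ}
    (f : (Fin N → X) → ℝ) : Prop :=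
  (∀ x, 0 ≤ f x) ∧ Integrable f (configMeasure ω N) ∧ ∫ x, f x ∂(configMeasure ω N) = 1

/-- The constant `Z_N (k) = ∫ det (k (x i) (x j)) dω(x 1) ⋯ dω(x N)`. -/
noncomputable def normalizationConstant {X : Type*} [MeasurableSpace X] (k : X → X → ℝ)
    (ω : Measure X) (N : ℕ) : ℝ :=
  ∫ x : Fin N → X, kernelDet k x ∂(configMeasure ω N)

/-- The volume-sampling density, i.e. `det (k (x i) (x j))` normalized by its integral. -/
noncomputable def vsDensity {X : Type*} [MeasurableSpace X] (k : X → X → ℝ)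
    (ω : Measure X) (N : ℕ) (x : Fin N → X) : ℝ :=
  (normalizationConstant k ω N)⁻¹ * kernelDet k x

/-- The collection of `N`-element sets of positive integers. -/
abbrev IndexSets (N : ℕ) : Type := {U : Finset ℕ+ // U.card = N}

end VolumeSampling

/-!
The theorem follows from Mercer's theorem and the Cauchy–Binet formula.

**Mercer's theorem** (`hasSum_kernel`). The kernel is a Gram kernel `k x y = ⟪φ x, φ y⟫` for a
feature map `φ` into its reproducing kernel Hilbert space `H`, and `φ` is continuous because `k` is.
Since `∫ k x x < ∞`, the map `J : H → L²(ω)`, `J h = ⟪φ ·, h⟫`, is a Hilbert–Schmidt operator, hence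
compact, and it is injective because continuous functions that vanish almost everywhere vanish
everywhere for a measure of full support. The integral operator of `k` is `J J†`, so the vectors
`J† (e m) / √(σ m)` with `σ m ≠ 0` are orthonormal in `H`. They are complete: otherwise the compact
self-adjoint operator `J† J` would have an eigenvector orthogonal to all of them, which `J` maps to
an eigenfunction that the exhaustiveness of the eigensystem rules out
(`eq_zero_of_forall_inner_adjoint_eq_zero`). Parseval's identity for `φ x` and `φ y` is then the
expansion `k x y = ∑ m, σ m * (e m x * e m y)` at every pair of points, with no compactness of the
space. Integrating the diagonal shows that the eigenvalues are summable.

**Cauchy–Binet** (`kernelDet_finite_rank`, `hasSum_kernelDet`). Truncating the Mercer series to a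
finite set `F` of indices gives a kernel of finite rank, whose determinant is a sum over the
`N`-element subsets of `F`. All terms are nonnegative, as `kernelDet (projectionKernel e U) x` is the
square of the determinant of `(e u (x i))`, so the limit over `F` is an unconditionally convergent
sum over all `N`-element sets.

**Integration.** The integral of the square of the determinant of `N` orthonormal functions is `N!`
(`integral_det_sq`), and the series of nonnegative terms is integrated term by term. Its value is
positive exactly when some product of `N` eigenvalues is, which for a non-increasing sequence means
`σ N > 0` (`tsum_prod_indexSets_pos_iff`).
-/

/-! ### Feature maps, Hilbert–Schmidt operators and the embedding into `L²` -/

namespace VolumeSampling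

open scoped InnerProductSpace Topology
open Filter

/-- A positive semi-definite kernel is a Gram kernel: `φ x` is the kernel function at `x` in the
reproducing kernel Hilbert space of `k`. The last clause says that the vectors `φ x` are total. -/
theorem exists_feature_map.{u} {X : Type u} (k : X → X → ℝ) (hk : (Matrix.of k).PosSemidef) :
    ∃ (H : Type u) (_ : NormedAddCommGroup H) (_ : InnerProductSpace ℝ H) (_ : CompleteSpace H)
      (φ : X → H), (∀ x y, ⟪φ x, φ y⟫_ℝ = k x y) ∧ ∀ h, (∀ x, ⟪φ x, h⟫_ℝ = 0) → h = 0 := by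
  -- Reproducing kernel Hilbert spaces have operator-valued kernels: `k x y` acts on `ℝ` as a scalar.
  let K : Matrix X X (ℝ →L[ℝ] ℝ) := .of fun x y => k x y • (1 : ℝ →L[ℝ] ℝ)
  have hK : K.PosSemidef := by
    have htfae := (RKHS.posSemidef_tfae (K := K)).out 0 2
    refine htfae.mpr ⟨?_, fun v => ?_⟩
    · ext x y
      have := hk.1.apply x y
      simp at this
      simp [K, this]
    · have := hk.2 v
      rw [Finsupp.sum_comm] at this
      simpa [K, mul_comm, mul_left_comm] using this
  have : Fact K.PosSemidef := ⟨hK⟩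
  refine ⟨RKHS.OfKernel K, inferInstance, inferInstance, inferInstance,
    fun x => RKHS.kerFun (RKHS.OfKernel K) x 1, fun x y => ?_, fun h hh => ?_⟩
  · have := RKHS.kernel_inner (RKHS.OfKernel K) x y (1 : ℝ) (1 : ℝ)
    rw [RKHS.OfKernel.kernel_ofKernel] at this
    rw [real_inner_comm, ← this]
    simp [K]
  · ext x
    simpa using hh x

/-- A Hilbert–Schmidt operator is compact: it is the norm limit of its compositions with the
orthogonal projections onto the spans of finitely many basis vectors. -/
theorem isCompactOperator_of_summable_norm_sq {ι H G : Type*} [NormedAddCommGroup H]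
    [InnerProductSpace ℝ H] [NormedAddCommGroup G] [NormedSpace ℝ G] [CompleteSpace G]
    (b : HilbertBasis ι ℝ H) (J : H →L[ℝ] G) (hJ : Summable fun i => ‖J (b i)‖ ^ 2) :
    IsCompactOperator J := by
  classical
  let T : Finset ι → H →L[ℝ] G := fun F => ∑ i ∈ F, (innerSL ℝ (b i)).smulRight (J (b i))
  have hT : ∀ F h, T F h = ∑ i ∈ F, ⟪b i, h⟫_ℝ • J (b i) := fun F h => by
    simp [T]
  refine isCompactOperator_of_tendsto (l := atTop) (F := T) ?_ (Eventually.of_forall fun F => ?_)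
  · rw [Metric.tendsto_atTop]
    intro ε hε
    obtain ⟨F, hF⟩ := summable_iff_vanishing_norm.mp hJ ((ε / 2) ^ 2) (by positivity)
    refine ⟨F, fun F₁ hF₁ => ?_⟩
    rw [dist_eq_norm, norm_sub_rev]
    refine lt_of_le_of_lt (ContinuousLinearMap.opNorm_le_bound _ (half_pos hε).le fun h => ?_)
      (half_lt_self hε)
    have hlim : Tendsto (fun F' => ‖T F' h - T F₁ h‖) atTop (𝓝 ‖(J - T F₁) h‖) := by
      have := (b.hasSum_repr h).mapL J
      have h2 : Tendsto (fun F' => T F' h) atTop (𝓝 (J h)) := by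
        simpa [HasSum, hT, HilbertBasis.repr_apply_apply] using this
      simpa using (h2.sub_const (T F₁ h)).norm
    refine le_of_tendsto hlim ((eventually_ge_atTop F₁).mono fun F' hF' => ?_)
    rw [hT, hT, ← Finset.sum_sdiff hF', add_sub_cancel_right]
    have hdisj : Disjoint (F' \ F₁) F :=
      Disjoint.mono_right hF₁ Finset.sdiff_disjoint
    have h1 := (hF _ hdisj).le
    rw [Real.norm_of_nonneg (Finset.sum_nonneg fun i _ => by positivity)] at h1
    have h2 : ∑ i ∈ F' \ F₁, ‖⟪b i, h⟫_ℝ‖ ^ 2 ≤ ‖h‖ ^ 2 := b.orthonormal.sum_inner_products_le h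
    calc ‖∑ i ∈ F' \ F₁, ⟪b i, h⟫_ℝ • J (b i)‖
        ≤ ∑ i ∈ F' \ F₁, ‖⟪b i, h⟫_ℝ‖ * ‖J (b i)‖ :=
          (norm_sum_le _ _).trans (le_of_eq (by simp [norm_smul]))
      _ ≤ √(∑ i ∈ F' \ F₁, ‖⟪b i, h⟫_ℝ‖ ^ 2) * √(∑ i ∈ F' \ F₁, ‖J (b i)‖ ^ 2) :=
          Real.sum_mul_le_sqrt_mul_sqrt _ _ _
      _ ≤ √(‖h‖ ^ 2) * √((ε / 2) ^ 2) := by gcongr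
      _ = ε / 2 * ‖h‖ := by
          rw [Real.sqrt_sq (norm_nonneg _), Real.sqrt_sq (half_pos hε).le, mul_comm]
  · have : ∀ i, IsCompactOperator ((innerSL ℝ (b i)).smulRight (J (b i))) := fun i => by
      have h1 : IsCompactOperator (innerSL ℝ (b i)) :=
        isCompactOperator_of_locallyCompactSpace_dom (innerSL ℝ (b i))
      exact h1.clm_comp (ContinuousLinearMap.toSpanSingleton ℝ (J (b i)))
    exact Submodule.sum_mem (compactOperator (RingHom.id ℝ) H G) (t := F) (fun i _ => this i)

section Embedding

variable {X : Type*} [TopologicalSpace X] [MeasurableSpace X] [BorelSpace X] {ω : Measure X}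
  {H : Type*} [NormedAddCommGroup H] [InnerProductSpace ℝ H] {φ : X → H}

omit [TopologicalSpace X] [BorelSpace X] in
theorem real_inner_toLp {f g : X → ℝ} (hf : MemLp f 2 ω) (hg : MemLp g 2 ω) :
    ⟪hf.toLp f, hg.toLp g⟫_ℝ = ∫ x, f x * g x ∂ω := by
  rw [L2.inner_def]
  refine integral_congr_ae ?_
  filter_upwards [hf.coeFn_toLp, hg.coeFn_toLp] with x h1 h2
  simp [h1, h2, mul_comm]

theorem memLp_inner_feature (hφ : Continuous φ) (hint : Integrable (fun x => ‖φ x‖ ^ 2) ω)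
    (h : H) : MemLp (fun x => ⟪φ x, h⟫_ℝ) 2 ω := by
  have hc : Continuous fun x => ⟪φ x, h⟫_ℝ := by fun_prop
  rw [memLp_two_iff_integrable_sq hc.aestronglyMeasurable]
  refine (hint.mul_const (‖h‖ ^ 2)).mono' (hc.pow 2).aestronglyMeasurable (.of_forall fun x => ?_)
  rw [Real.norm_of_nonneg (sq_nonneg _), ← mul_pow, ← sq_abs]
  gcongr
  exact abs_real_inner_le_norm _ _

/-- The map `h ↦ ⟪φ ·, h⟫` is a bounded operator into `L²(ω)`. -/
theorem exists_embedding (hφ : Continuous φ) (hint : Integrable (fun x => ‖φ x‖ ^ 2) ω) :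
    ∃ J : H →L[ℝ] Lp ℝ 2 ω,
      ∀ h, J h = (memLp_inner_feature hφ hint h).toLp fun x => ⟪φ x, h⟫_ℝ := by
  let J₀ : H →ₗ[ℝ] Lp ℝ 2 ω :=
    { toFun := fun h => (memLp_inner_feature hφ hint h).toLp fun x => ⟪φ x, h⟫_ℝ
      map_add' := fun f g => by
        rw [← MemLp.toLp_add]
        exact MemLp.toLp_congr _ _ (.of_forall fun x => by simp [inner_add_right])
      map_smul' := fun c f => by
        rw [RingHom.id_apply, ← MemLp.toLp_const_smul]
        exact MemLp.toLp_congr _ _ (.of_forall fun x => by simp [inner_smul_right]) }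
  refine ⟨J₀.mkContinuous √(∫ x, ‖φ x‖ ^ 2 ∂ω) fun h => ?_, fun h => rfl⟩
  rw [← sq_le_sq₀ (norm_nonneg _) (by positivity), mul_pow,
    Real.sq_sqrt (integral_nonneg fun x => by positivity), ← real_inner_self_eq_norm_sq]
  change ⟪(memLp_inner_feature hφ hint h).toLp _, (memLp_inner_feature hφ hint h).toLp _⟫_ℝ ≤ _
  rw [real_inner_toLp, ← integral_mul_const]
  refine integral_mono ((memLp_inner_feature hφ hint h).integrable_mul
    (memLp_inner_feature hφ hint h)) (hint.mul_const _) fun x => ?_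
  simp only [← sq, ← mul_pow]
  rw [← sq_abs]
  gcongr
  exact abs_real_inner_le_norm _ _

/-- The embedding is Hilbert–Schmidt: by Bessel's inequality at each `φ x`, the sum of the squared
norms of the images of an orthonormal basis is at most `∫ ‖φ x‖²`. -/
theorem isCompactOperator_embedding [CompleteSpace H] (hφ : Continuous φ)
    (hint : Integrable (fun x => ‖φ x‖ ^ 2) ω) (J : H →L[ℝ] Lp ℝ 2 ω)
    (hJ : ∀ h, J h = (memLp_inner_feature hφ hint h).toLp fun x => ⟪φ x, h⟫_ℝ) :
    IsCompactOperator J := by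
  obtain ⟨w, b, -⟩ := exists_hilbertBasis ℝ H
  refine isCompactOperator_of_summable_norm_sq b J
    (summable_of_sum_le (c := ∫ x, ‖φ x‖ ^ 2 ∂ω) (fun i => sq_nonneg _) fun F => ?_)
  have hi : ∀ i ∈ F, Integrable (fun x => ⟪φ x, b i⟫_ℝ * ⟪φ x, b i⟫_ℝ) ω := fun i _ =>
    (memLp_inner_feature hφ hint _).integrable_mul (memLp_inner_feature hφ hint _)
  simp_rw [← real_inner_self_eq_norm_sq (J _), hJ, real_inner_toLp]
  rw [← integral_finsetSum _ hi]
  refine integral_mono (integrable_finsetSum _ hi) hint fun x => ?_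
  refine le_of_eq_of_le ?_ (b.orthonormal.sum_inner_products_le (φ x) (s := F))
  refine Finset.sum_congr rfl fun i _ => ?_
  rw [real_inner_comm, Real.norm_eq_abs, sq_abs, sq]

end Embedding

end VolumeSampling

/-! ### Mercer's theorem -/

namespace VolumeSampling

open scoped InnerProductSpace Topology
open Filter

section Mercer

variable {X : Type*} [TopologicalSpace X] [MeasurableSpace X] [BorelSpace X] {ω : Measure X}
  {k : X → X → ℝ} {σ : ℕ+ → ℝ} {e : ℕ+ → X → ℝ}
  {H : Type*} [NormedAddCommGroup H] [InnerProductSpace ℝ H] {φ : X → H}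

omit [MeasurableSpace X] [BorelSpace X] in
theorem continuous_feature_map (hk : Continuous (Function.uncurry k))
    (hφk : ∀ x y, ⟪φ x, φ y⟫_ℝ = k x y) : Continuous φ := by
  rw [continuous_iff_continuousAt]
  intro x₀
  rw [ContinuousAt, tendsto_iff_norm_sub_tendsto_zero]
  have hsq : ∀ x, ‖φ x - φ x₀‖ = √(k x x - 2 * k x x₀ + k x₀ x₀) := fun x => by
    rw [← hφk, ← hφk, ← hφk, real_inner_self_eq_norm_sq, real_inner_self_eq_norm_sq,
      ← norm_sub_sq_real, Real.sqrt_sq (norm_nonneg _)]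
  simp_rw [hsq]
  have h1 : Continuous fun x => k x x := hk.comp (continuous_id.prodMk continuous_id)
  have h2 : Continuous fun x => k x x₀ := hk.comp (continuous_id.prodMk continuous_const)
  have h3 : Continuous fun x => √(k x x - 2 * k x x₀ + k x₀ x₀) := by fun_prop
  have := h3.tendsto x₀
  convert! this using 2
  rw [show k x₀ x₀ - 2 * k x₀ x₀ + k x₀ x₀ = 0 by ring, Real.sqrt_zero]

variable [CompleteSpace H]

/-- The adjoint of the embedding sends `f` to the element of the feature space that represents the
function `Σ f`, at every point. -/
theorem inner_feature_adjoint (hφk : ∀ x y, ⟪φ x, φ y⟫_ℝ = k x y) (hφ : Continuous φ)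
    (hint : Integrable (fun x => ‖φ x‖ ^ 2) ω) {J : H →L[ℝ] Lp ℝ 2 ω}
    (hJ : ∀ h, J h = (memLp_inner_feature hφ hint h).toLp fun x => ⟪φ x, h⟫_ℝ)
    {f : X → ℝ} (hf : MemLp f 2 ω) (x : X) :
    ⟪φ x, J.adjoint (hf.toLp f)⟫_ℝ = integralOperator k ω f x := by
  rw [ContinuousLinearMap.adjoint_inner_right, hJ, real_inner_toLp, integralOperator]
  simp_rw [real_inner_comm (φ x), hφk]

theorem eigenfunction_adjoint_apply (he : IsEigensystem k ω σ e)
    (hφk : ∀ x y, ⟪φ x, φ y⟫_ℝ = k x y) (hφ : Continuous φ)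
    (hint : Integrable (fun x => ‖φ x‖ ^ 2) ω) {J : H →L[ℝ] Lp ℝ 2 ω}
    (hJ : ∀ h, J h = (memLp_inner_feature hφ hint h).toLp fun x => ⟪φ x, h⟫_ℝ) (m : ℕ+) :
    J (J.adjoint ((he.memLp m).toLp (e m))) = σ m • (he.memLp m).toLp (e m) := by
  rw [hJ, ← MemLp.toLp_const_smul]
  refine MemLp.toLp_congr _ _ (.of_forall fun x => ?_)
  simp [inner_feature_adjoint hφk hφ hint hJ, he.eigen]

theorem inner_adjoint_eigenfunction (he : IsEigensystem k ω σ e)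
    (hφk : ∀ x y, ⟪φ x, φ y⟫_ℝ = k x y) (hφ : Continuous φ)
    (hint : Integrable (fun x => ‖φ x‖ ^ 2) ω) {J : H →L[ℝ] Lp ℝ 2 ω}
    (hJ : ∀ h, J h = (memLp_inner_feature hφ hint h).toLp fun x => ⟪φ x, h⟫_ℝ) (m n : ℕ+) :
    ⟪J.adjoint ((he.memLp m).toLp (e m)), J.adjoint ((he.memLp n).toLp (e n))⟫_ℝ =
      if m = n then σ n else 0 := by
  rw [ContinuousLinearMap.adjoint_inner_left, eigenfunction_adjoint_apply he hφk hφ hint hJ,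
    inner_smul_right, real_inner_toLp, he.orthonormal]
  simp

/-- The vectors `J† (e m)` span a dense subspace of the feature space: otherwise the compact
self-adjoint operator `J† J`, compressed to their orthogonal complement, would have an eigenvector
with nonzero eigenvalue, and its image under `J` would contradict the exhaustiveness of `e`. -/
theorem eq_zero_of_forall_inner_adjoint_eq_zero [ω.IsOpenPosMeasure] (he : IsEigensystem k ω σ e)
    (hφk : ∀ x y, ⟪φ x, φ y⟫_ℝ = k x y) (hφ0 : ∀ h, (∀ x, ⟪φ x, h⟫_ℝ = 0) → h = 0)
    (hφ : Continuous φ)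
    (hint : Integrable (fun x => ‖φ x‖ ^ 2) ω) {J : H →L[ℝ] Lp ℝ 2 ω}
    (hJ : ∀ h, J h = (memLp_inner_feature hφ hint h).toLp fun x => ⟪φ x, h⟫_ℝ)
    {h : H} (hh : ∀ m, ⟪J.adjoint ((he.memLp m).toLp (e m)), h⟫_ℝ = 0) : h = 0 := by
  have hinj : ∀ g, (∀ᵐ x ∂ω, ⟪φ x, g⟫_ℝ = 0) → g = 0 := fun g hg => by
    have hc : Continuous fun x => ⟪φ x, g⟫_ℝ := by fun_prop
    exact hφ0 g fun x => congrFun ((hc.ae_eq_iff_eq ω continuous_const).mp hg) x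
  -- `W` is the orthogonal complement of the `J† (e m)`, and `A` the compression of `J† J` to it.
  let W : Submodule ℝ H :=
    (Submodule.span ℝ (Set.range fun m => J.adjoint ((he.memLp m).toLp (e m))))ᗮ
  have hW : ∀ g, g ∈ W ↔ ∀ m, ⟪J.adjoint ((he.memLp m).toLp (e m)), g⟫_ℝ = 0 := fun g => by
    simp only [W, ← Submodule.span_singleton_le_iff_mem]
    rw [← Submodule.isOrtho_iff_le, Submodule.isOrtho_comm, Submodule.isOrtho_span]
    simp
  have hWinv : ∀ g ∈ W, J.adjoint (J g) ∈ W := fun g hg => by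
    rw [hW] at hg ⊢
    intro m
    rw [ContinuousLinearMap.adjoint_inner_right, eigenfunction_adjoint_apply he hφk hφ hint hJ,
      inner_smul_left, ← ContinuousLinearMap.adjoint_inner_left, hg, mul_zero]
  have : CompleteSpace W := (Submodule.isClosed_orthogonal _).completeSpace_coe
  let P : H →L[ℝ] H := W.starProjection
  let A : H →L[ℝ] H := P ∘L (J.adjoint ∘L J) ∘L P
  have hPsymm : ∀ a b, ⟪P a, b⟫_ℝ = ⟪a, P b⟫_ℝ := fun a b =>
    Submodule.inner_starProjection_left_eq_right W a b
  have hPmem : ∀ g ∈ W, P g = g := fun g hg => Submodule.starProjection_eq_self_iff.mpr hg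
  have hA : IsCompactOperator A := by
    have := ((isCompactOperator_embedding hφ hint J hJ).clm_comp J.adjoint).comp_clm P
    exact this.clm_comp P
  have hAsymm : (A : H →ₗ[ℝ] H).IsSymmetric := fun a b => by
    simp [A, ← hPsymm a, hPsymm _ b, ContinuousLinearMap.adjoint_inner_left,
      ContinuousLinearMap.adjoint_inner_right]
  have hA0 : A = 0 := by
    rw [← ContinuousLinearMap.eq_zero_of_forall_hasEigenvalue_eq_zero hA hAsymm]
    intro c hc
    by_contra hc0
    obtain ⟨g, hg⟩ := hc.exists_hasEigenvector
    have hAg : A g = c • g := hg.apply_eq_smul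
    have hgW : g ∈ W := by
      have h1 : c • g ∈ W := hAg ▸ W.starProjection_apply_mem _
      simpa [smul_smul, inv_mul_cancel₀ hc0] using W.smul_mem c⁻¹ h1
    have hSg : J.adjoint (J g) = c • g := by
      rw [← hAg]
      simp [A, hPmem g hgW, hPmem _ (hWinv g hgW)]
    -- `J g = ⟪φ ·, g⟫` is an eigenfunction of `Σ = J J†`, orthogonal to every `e m`.
    refine hg.2 (hinj g (he.exhaustive _ c (memLp_inner_feature hφ hint g) hc0 ?_ fun m => ?_))
    · refine .of_forall fun x => ?_
      rw [← inner_feature_adjoint hφk hφ hint hJ (memLp_inner_feature hφ hint g), ← hJ, hSg,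
        inner_smul_right]
    · rw [← real_inner_toLp (memLp_inner_feature hφ hint g) (he.memLp m), ← hJ,
        ← ContinuousLinearMap.adjoint_inner_right, real_inner_comm]
      exact (hW g).mp hgW m
  have hhW : h ∈ W := (hW h).mpr hh
  have hJh : J h = 0 := by
    have h1 : ⟪A h, h⟫_ℝ = 0 := by simp [hA0]
    simpa [A, hPsymm, hPmem h hhW, ContinuousLinearMap.adjoint_inner_left] using h1
  rw [hJ] at hJh
  refine hinj h ?_
  filter_upwards [(memLp_inner_feature hφ hint h).coeFn_toLp, Lp.coeFn_zero ℝ 2 ω] with x h1 h2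
  rw [← h1, hJh, h2, Pi.zero_apply]

/-- Mercer's theorem, at every pair of points, together with the nonnegativity of the eigenvalues.
The terms with `σ m = 0`, where `e m` is not represented in the feature space, vanish. -/
theorem hasSum_kernel {X : Type*} [TopologicalSpace X] [MeasurableSpace X]
    [BorelSpace X] {ω : Measure X} [ω.IsOpenPosMeasure]
    {k : X → X → ℝ} (hk_cont : Continuous (Function.uncurry k)) (hk_pos : (Matrix.of k).PosSemidef)
    (hk_int : Integrable (fun x => k x x) ω) {σ : ℕ+ → ℝ} {e : ℕ+ → X → ℝ}
    (he : IsEigensystem k ω σ e) :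
    (∀ m, 0 ≤ σ m) ∧ ∀ x y, HasSum (fun m => σ m * (e m x * e m y)) (k x y) := by
  obtain ⟨H, _, _, _, φ, hφk, hφ0⟩ := exists_feature_map k hk_pos
  have hφ : Continuous φ := continuous_feature_map hk_cont hφk
  have hint : Integrable (fun x => ‖φ x‖ ^ 2) ω := by
    simpa only [← real_inner_self_eq_norm_sq, hφk] using hk_int
  obtain ⟨J, hJ⟩ := exists_embedding (ω := ω) hφ hint
  let g : ℕ+ → H := fun m => J.adjoint ((he.memLp m).toLp (e m))
  have hgg : ∀ m n, ⟪g m, g n⟫_ℝ = if m = n then σ n else 0 :=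
    inner_adjoint_eigenfunction he hφk hφ hint hJ
  have hφg : ∀ x m, ⟪φ x, g m⟫_ℝ = σ m * e m x := fun x m => by
    rw [inner_feature_adjoint hφk hφ hint hJ, he.eigen]
  have hσ : ∀ m, 0 ≤ σ m := fun m => by
    have := hgg m m
    rw [if_pos rfl] at this
    exact this ▸ real_inner_self_nonneg
  have hg0 : ∀ m, σ m = 0 → g m = 0 := fun m hm => by
    rw [← inner_self_eq_zero (𝕜 := ℝ), hgg, if_pos rfl, hm]
  refine ⟨hσ, fun x y => ?_⟩
  let v : {m // σ m ≠ 0} → H := fun m => (√(σ m))⁻¹ • g m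
  have hv : Orthonormal ℝ v := by
    rw [orthonormal_iff_ite]
    rintro ⟨m, hm⟩ ⟨n, hn⟩
    have hn' : √(σ n) ≠ 0 := by rwa [Real.sqrt_ne_zero (hσ n)]
    simp only [v, inner_smul_left, inner_smul_right, hgg, Subtype.mk.injEq]
    split_ifs with h
    · subst h
      simp only [map_inv₀, conj_trivial]
      field_simp
      rw [Real.sq_sqrt (hσ m)]
    · simp
  have hdense : (Submodule.span ℝ (Set.range v))ᗮ = ⊥ := by
    rw [Submodule.eq_bot_iff]
    intro h hh
    refine eq_zero_of_forall_inner_adjoint_eq_zero he hφk hφ0 hφ hint hJ fun m => ?_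
    change ⟪g m, h⟫_ℝ = 0
    by_cases hm : σ m = 0
    · rw [hg0 m hm, inner_zero_left]
    · have h1 := (Submodule.mem_orthogonal _ _).mp hh _ (Submodule.subset_span ⟨⟨m, hm⟩, rfl⟩)
      have hm' : √(σ m) ≠ 0 := by rwa [Real.sqrt_ne_zero (hσ m)]
      simpa [v, inner_smul_left, hm'] using h1
  have hsum := (HilbertBasis.mkOfOrthogonalEqBot hv hdense).hasSum_inner_mul_inner (φ x) (φ y)
  rw [hφk, HilbertBasis.coe_mkOfOrthogonalEqBot] at hsum
  rw [← hasSum_subtype_iff_of_support_subset (s := {m | σ m ≠ 0})]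
  · refine hsum.congr_fun ?_
    rintro ⟨m, hm⟩
    have hm' : √(σ m) ≠ 0 := by rwa [Real.sqrt_ne_zero (hσ m)]
    simp only [v, inner_smul_right, real_inner_comm (φ y), hφg, Function.comp]
    field_simp
    rw [Real.sq_sqrt (hσ m)]
    ring
  · intro m hm
    simp only [Function.mem_support] at hm
    exact left_ne_zero_of_mul hm

end Mercer

/-- The eigenvalues are summable, because their partial sums are bounded by the integral of `k`
over the diagonal. -/
theorem IsEigensystem.summable_eigenvalues {X : Type*} [TopologicalSpace X] [MeasurableSpace X]
    [BorelSpace X] {ω : Measure X} [ω.IsOpenPosMeasure]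
    {k : X → X → ℝ} (hk_cont : Continuous (Function.uncurry k)) (hk_pos : (Matrix.of k).PosSemidef)
    (hk_int : Integrable (fun x => k x x) ω) {σ : ℕ+ → ℝ} {e : ℕ+ → X → ℝ}
    (he : IsEigensystem k ω σ e) : Summable σ := by
  obtain ⟨hσ, hsum⟩ := hasSum_kernel hk_cont hk_pos hk_int he
  refine summable_of_sum_le (c := ∫ x, k x x ∂ω) hσ fun F => ?_
  have hi : ∀ m ∈ F, Integrable (fun x => σ m * (e m x * e m x)) ω := fun m _ =>
    ((he.memLp m).integrable_mul (he.memLp m)).const_mul _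
  have h1 : ∀ m, σ m = ∫ x, σ m * (e m x * e m x) ∂ω := fun m => by
    rw [integral_const_mul, he.orthonormal, if_pos rfl, mul_one]
  rw [Finset.sum_congr rfl fun m _ => h1 m, ← integral_finsetSum _ hi]
  exact integral_mono (integrable_finsetSum _ hi) hk_int fun x =>
    sum_le_hasSum F (fun m _ => mul_nonneg (hσ m) (mul_self_nonneg _)) (hsum x x)

end VolumeSampling

/-! ### The Cauchy–Binet formula for kernels -/

namespace VolumeSampling

open scoped Topology
open Filter

section Determinant

variable {X ι : Type*} {N : ℕ}

/-- Expansion of the determinant of a finite sum of rank-one matrices by multilinearity in the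
rows. -/
theorem det_sum_mul (F : Finset ι) (f g : ι → Fin N → ℝ) :
    Matrix.det (Matrix.of fun i j => ∑ m ∈ F, f m i * g m j) =
      ∑ p ∈ Fintype.piFinset fun _ : Fin N => F,
        (∏ i, f (p i) i) * Matrix.det (Matrix.of fun i j => g (p i) j) := by
  classical
  have h1 : (Matrix.of fun i j => ∑ m ∈ F, f m i * g m j) =
      fun i => ∑ m ∈ F, f m i • g m := by
    ext i j
    simp
  have h2 := (Matrix.detRowAlternating (R := ℝ) (n := Fin N)).toMultilinearMap.map_sum_finset
    (fun i m => f m i • g m) (fun _ => F)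
  rw [h1]
  refine h2.trans (Finset.sum_congr rfl fun p _ => ?_)
  exact (Matrix.detRowAlternating (R := ℝ) (n := Fin N)).toMultilinearMap.map_smul_univ
    (fun i => f (p i) i) (fun i => g (p i))

theorem image_eq_of_injective [DecidableEq ι] {U : Finset ι} (hU : U.card = N) {p : Fin N → ι}
    (hp : Function.Injective p) (hpU : ∀ i, p i ∈ U) : Finset.univ.image p = U :=
  Finset.eq_of_subset_of_card_le (Finset.image_subset_iff.mpr fun i _ => hpU i)
    (by rw [Finset.card_image_of_injective _ hp, hU, Finset.card_fin])

/-- The Cauchy–Binet formula for kernels of finite rank. -/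
theorem kernelDet_finite_rank (σ : ℕ+ → ℝ) (e : ℕ+ → X → ℝ) (F : Finset ℕ+) (x : Fin N → X) :
    kernelDet (fun y z => ∑ m ∈ F, σ m * (e m y * e m z)) x =
      ∑ U ∈ F.powersetCard N, (∏ u ∈ U, σ u) * kernelDet (projectionKernel e U) x := by
  let G : (Fin N → ℕ+) → ℝ := fun p =>
    (∏ i, e (p i) (x i)) * Matrix.det (Matrix.of fun i j => e (p i) (x j))
  have hG : ∀ p, ¬ Function.Injective p → G p = 0 := fun p hp => by
    obtain ⟨i, j, hij, hne⟩ := Function.not_injective_iff.mp hp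
    refine mul_eq_zero_of_right _ (Matrix.det_zero_of_row_eq hne ?_)
    ext l
    simp [hij]
  have hF : kernelDet (fun y z => ∑ m ∈ F, σ m * (e m y * e m z)) x =
      ∑ p ∈ Fintype.piFinset fun _ : Fin N => F, (∏ i, σ (p i)) * G p := by
    simp only [kernelDet, ← mul_assoc]
    rw [det_sum_mul F (fun m i => σ m * e m (x i)) (fun m j => e m (x j))]
    simp only [G, Finset.prod_mul_distrib, mul_assoc]
  have hU : ∀ U, kernelDet (projectionKernel e U) x =
      ∑ p ∈ Fintype.piFinset fun _ : Fin N => U, G p := fun U =>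
    det_sum_mul U (fun m i => e m (x i)) (fun m j => e m (x j))
  have hinj : ∀ (V : Finset ℕ+) (a : (Fin N → ℕ+) → ℝ),
      ∑ p ∈ Fintype.piFinset fun _ : Fin N => V, a p * G p =
        ∑ p ∈ (Fintype.piFinset fun _ : Fin N => V) with Function.Injective p, a p * G p :=
    fun V a => (Finset.sum_filter_of_ne fun p _ hp => by
      by_contra h
      exact hp (by rw [hG p h, mul_zero])).symm
  rw [hF, hinj]
  -- Only injective maps `Fin N → F` contribute; group them by their image, a set of size `N`.
  rw [← Finset.sum_fiberwise_of_maps_to (t := F.powersetCard N)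
    (g := fun p => Finset.univ.image p)]
  · refine Finset.sum_congr rfl fun U hUF => ?_
    obtain ⟨hUF, hcard⟩ := Finset.mem_powersetCard.mp hUF
    have h1 := hinj U fun _ => 1
    simp only [one_mul] at h1
    rw [hU, h1, Finset.mul_sum]
    refine Finset.sum_congr ?_ fun p hp => ?_
    · ext p
      simp only [Finset.mem_filter, Fintype.mem_piFinset]
      constructor
      · rintro ⟨⟨-, hp⟩, rfl⟩
        exact ⟨fun i => Finset.mem_image_of_mem _ (Finset.mem_univ i), hp⟩
      · rintro ⟨hpU, hp⟩
        exact ⟨⟨fun i => hUF (hpU i), hp⟩, image_eq_of_injective hcard hp hpU⟩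
    · simp only [Finset.mem_filter, Fintype.mem_piFinset] at hp
      rw [← image_eq_of_injective hcard hp.2 hp.1, Finset.prod_image fun i _ j _ h => hp.2 h]
  · intro p hp
    simp only [Finset.mem_filter, Fintype.mem_piFinset] at hp
    rw [Finset.mem_powersetCard, Finset.card_image_of_injective _ hp.2, Finset.card_fin]
    exact ⟨Finset.image_subset_iff.mpr fun i _ => hp.1 i, rfl⟩

/-- For `N` indices, the kernel matrix of `𝔎_U` is `A Aᵀ` for a square matrix `A`, so that its
determinant is a square. -/
theorem kernelDet_projectionKernel (e : ℕ+ → X → ℝ) {U : Finset ℕ+} (hU : U.card = N)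
    (x : Fin N → X) :
    kernelDet (projectionKernel e U) x =
      Matrix.det (Matrix.of fun i j => e (U.orderEmbOfFin hU j) (x i)) ^ 2 := by
  rw [sq]
  nth_rewrite 2 [← Matrix.det_transpose]
  rw [← Matrix.det_mul, kernelDet]
  congr 1
  ext i j
  simp only [Matrix.of_apply, Matrix.mul_apply, Matrix.transpose_apply, projectionKernel]
  nth_rewrite 1 [← Finset.image_orderEmbOfFin_univ U hU]
  rw [Finset.sum_image fun a _ b _ h => (U.orderEmbOfFin hU).injective h]

theorem kernelDet_projectionKernel_nonneg (e : ℕ+ → X → ℝ) {U : Finset ℕ+} (hU : U.card = N)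
    (x : Fin N → X) : 0 ≤ kernelDet (projectionKernel e U) x := by
  rw [kernelDet_projectionKernel e hU]
  exact sq_nonneg _

/-- The infinite Cauchy–Binet formula. All terms are nonnegative, so the sum over `N`-element sets
is the supremum of the sums over the `N`-element subsets of a finite set `F`, which are the
determinants of the truncated kernels. -/
theorem hasSum_kernelDet {k : X → X → ℝ} {σ : ℕ+ → ℝ} {e : ℕ+ → X → ℝ} (hσ : ∀ m, 0 ≤ σ m)
    (hk : ∀ x y, HasSum (fun m => σ m * (e m x * e m y)) (k x y)) (x : Fin N → X) :
    HasSum (fun U : IndexSets N => (∏ u ∈ U.1, σ u) * kernelDet (projectionKernel e U.1) x)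
      (kernelDet k x) := by
  let a : Finset ℕ+ → ℝ := fun U => (∏ u ∈ U, σ u) * kernelDet (projectionKernel e U) x
  have ha0 : ∀ U : IndexSets N, 0 ≤ a U.1 := fun U =>
    mul_nonneg (Finset.prod_nonneg fun u _ => hσ u) (kernelDet_projectionKernel_nonneg e U.2 x)
  let S : Finset ℕ+ → Finset (IndexSets N) := fun F =>
    (F.powersetCard N).subtype fun U => U.card = N
  have hS : ∀ F, ∑ U ∈ S F, a U.1 = ∑ U ∈ F.powersetCard N, a U := fun F =>
    Finset.sum_subtype_of_mem a fun U hU => (Finset.mem_powersetCard.mp hU).2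
  have hmono : Monotone fun F => ∑ U ∈ S F, a U.1 := fun F F' h =>
    Finset.sum_le_sum_of_subset_of_nonneg
      (Finset.subtype_mono (Finset.powersetCard_mono h)) fun U _ _ => ha0 U
  have hlim : Tendsto (fun F => ∑ U ∈ S F, a U.1) atTop (𝓝 (kernelDet k x)) := by
    refine Tendsto.congr (fun F => (kernelDet_finite_rank σ e F x).trans (hS F).symm) ?_
    exact (continuous_id.matrix_det.tendsto _).comp
      (tendsto_pi_nhds.mpr fun i => tendsto_pi_nhds.mpr fun j => hk (x i) (x j))
  refine hasSum_of_isLUB_of_nonneg _ ha0 ⟨?_, fun b hb => ?_⟩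
  · rintro _ ⟨s, rfl⟩
    refine le_trans (Finset.sum_le_sum_of_subset_of_nonneg (t := S (s.sup fun U => U.1)) ?_
      fun U _ _ => ha0 U) (hmono.ge_of_tendsto hlim _)
    intro U hU
    simp only [S, Finset.mem_subtype, Finset.mem_powersetCard]
    exact ⟨Finset.le_sup (f := fun U : IndexSets N => U.1) hU, U.2⟩
  · exact le_of_tendsto' hlim fun F => hb ⟨S F, rfl⟩

end Determinant

/-! ### Integration of determinants and of nonnegative series -/

section Integral

variable {X : Type*} [MeasurableSpace X] {ω : Measure X} [SigmaFinite ω] {N : ℕ}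

/-- The squared determinant of `N` orthonormal functions, evaluated at `N` points, has integral
`N!`: of the products over two permutations only the diagonal ones contribute. -/
theorem integral_det_sq {f : Fin N → X → ℝ} (hf : ∀ j, MemLp (f j) 2 ω)
    (horth : ∀ i j, ∫ x, f i x * f j x ∂ω = if i = j then 1 else 0) :
    Integrable (fun x : Fin N → X => Matrix.det (Matrix.of fun i j => f j (x i)) ^ 2)
        (configMeasure ω N) ∧
      ∫ x, Matrix.det (Matrix.of fun i j => f j (x i)) ^ 2 ∂(configMeasure ω N) =
        (N.factorial : ℝ) := by
  have hexp : ∀ x : Fin N → X, Matrix.det (Matrix.of fun i j => f j (x i)) ^ 2 =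
      ∑ π : Equiv.Perm (Fin N), ∑ τ : Equiv.Perm (Fin N),
        ((Equiv.Perm.sign π : ℤ) * (Equiv.Perm.sign τ : ℤ) : ℝ) *
          ∏ i, f (π i) (x i) * f (τ i) (x i) := fun x => by
    rw [← Matrix.det_transpose, sq, Matrix.det_apply', Finset.sum_mul_sum]
    refine Finset.sum_congr rfl fun π _ => Finset.sum_congr rfl fun τ _ => ?_
    simp only [Matrix.transpose_apply, Matrix.of_apply, Finset.prod_mul_distrib]
    ring
  have hint : ∀ π τ : Equiv.Perm (Fin N), Integrable (fun x : Fin N → X =>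
      ((Equiv.Perm.sign π : ℤ) * (Equiv.Perm.sign τ : ℤ) : ℝ) *
        ∏ i, f (π i) (x i) * f (τ i) (x i)) (configMeasure ω N) := fun π τ =>
    (Integrable.fintype_prod fun i => (hf (π i)).integrable_mul (hf (τ i))).const_mul _
  simp_rw [hexp]
  refine ⟨integrable_finsetSum _ fun π _ => integrable_finsetSum _ fun τ _ => hint π τ, ?_⟩
  rw [integral_finsetSum _ fun π _ => integrable_finsetSum _ fun τ _ => hint π τ]
  have hone : ∀ π : Equiv.Perm (Fin N), ∫ x : Fin N → X, ∑ τ : Equiv.Perm (Fin N),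
      ((Equiv.Perm.sign π : ℤ) * (Equiv.Perm.sign τ : ℤ) : ℝ) *
        ∏ i, f (π i) (x i) * f (τ i) (x i) ∂(configMeasure ω N) = 1 := fun π => by
    rw [integral_finsetSum _ fun τ _ => hint π τ, Finset.sum_eq_single π]
    · rw [integral_const_mul, configMeasure,
        integral_fintype_prod_eq_prod (fun i y => f (π i) y * f (π i) y)]
      simp only [horth, if_true, Finset.prod_const_one, mul_one, ← Int.cast_mul]
      simp [← Units.val_mul, Int.units_mul_self]
    · intro τ _ hτ
      obtain ⟨i, hi⟩ : ∃ i, π i ≠ τ i := by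
        by_contra! h
        exact hτ (Equiv.ext h).symm
      rw [integral_const_mul, configMeasure,
        integral_fintype_prod_eq_prod (fun i y => f (π i) y * f (τ i) y)]
      refine mul_eq_zero_of_right _ (Finset.prod_eq_zero (Finset.mem_univ i) ?_)
      rw [horth, if_neg hi]
    · simp
  simp_rw [hone]
  simp [Fintype.card_perm]

theorem IsEigensystem.integral_kernelDet_projectionKernel {k : X → X → ℝ} {σ : ℕ+ → ℝ}
    {e : ℕ+ → X → ℝ} (he : IsEigensystem k ω σ e) {U : Finset ℕ+} (hU : U.card = N) :
    Integrable (kernelDet (N := N) (projectionKernel e U)) (configMeasure ω N) ∧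
      ∫ x, kernelDet (N := N) (projectionKernel e U) x ∂(configMeasure ω N) =
        (N.factorial : ℝ) := by
  have h := integral_det_sq (fun j => he.memLp (U.orderEmbOfFin hU j)) fun i j => by
    rw [he.orthonormal]
    simp
  simp_rw [← kernelDet_projectionKernel e hU] at h
  exact h

/-- A pointwise convergent series of nonnegative integrable functions with summable integrals has
an integrable sum, and can be integrated term by term. -/
theorem integrable_and_hasSum_integral {α ι : Type*} [Countable ι] [MeasurableSpace α]
    {μ : Measure α} {F : ι → α → ℝ} {f : α → ℝ} (hF0 : ∀ i a, 0 ≤ F i a)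
    (hF : ∀ i, Integrable (F i) μ) (hsum : Summable fun i => ∫ a, F i a ∂μ)
    (hf : ∀ a, HasSum (fun i => F i a) (f a)) :
    Integrable f μ ∧ HasSum (fun i => ∫ a, F i a ∂μ) (∫ a, f a ∂μ) := by
  have hnorm : ∀ i, ∫ a, ‖F i a‖ ∂μ = ∫ a, F i a ∂μ := fun i =>
    integral_congr_ae (.of_forall fun a => Real.norm_of_nonneg (hF0 i a))
  refine ⟨?_, ?_⟩
  · have hmeas : AEStronglyMeasurable f μ :=
      aestronglyMeasurable_of_tendsto_ae (u := atTop) (f := fun (s : Finset ι) a => ∑ i ∈ s, F i a)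
        (fun s => (integrable_finsetSum s fun i _ => hF i).aestronglyMeasurable)
        (.of_forall fun a => hf a)
    refine ⟨hmeas, ?_⟩
    have h1 : ∀ a, ‖f a‖ₑ = ∑' i, ENNReal.ofReal (F i a) := fun a => by
      rw [← (hf a).tsum_eq, ← ENNReal.ofReal_tsum_of_nonneg (fun i => hF0 i a) (hf a).summable,
        Real.enorm_of_nonneg (tsum_nonneg fun i => hF0 i a)]
    rw [HasFiniteIntegral]
    simp_rw [h1]
    rw [lintegral_tsum fun i => (hF i).aestronglyMeasurable.aemeasurable.ennreal_ofReal]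
    simp_rw [← ofReal_integral_eq_lintegral_ofReal (hF _) (.of_forall (hF0 _))]
    rw [← ENNReal.ofReal_tsum_of_nonneg (fun i => integral_nonneg (hF0 i)) hsum]
    exact ENNReal.ofReal_lt_top
  · have := hasSum_integral_of_summable_integral_norm hF (by simpa only [hnorm] using hsum)
    simpa only [(hf _).tsum_eq] using this

end Integral

end VolumeSampling

/-! ### Sums of products of eigenvalues -/

namespace VolumeSampling

open Filter

section EigenvalueSums

variable {σ : ℕ+ → ℝ}

theorem summable_prod_indexSets (hσ : ∀ m, 0 ≤ σ m) (hsum : Summable σ) (N : ℕ) :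
    Summable fun U : IndexSets N => ∏ u ∈ U.1, σ u :=
  (summable_finsetProd_of_summable_nonneg hσ hsum).comp_injective Subtype.val_injective

/-- An `N`-element set of indices has an element `≥ N`, so a nonzero product of `N` eigenvalues
forces `σ N > 0`; the set `{1, …, N}` gives the converse. -/
theorem tsum_prod_indexSets_pos_iff (hσ : ∀ m, 0 ≤ σ m) (hanti : Antitone σ) (hsum : Summable σ)
    (N : ℕ+) : 0 < ∑' U : IndexSets N, ∏ u ∈ U.1, σ u ↔ 0 < σ N := by
  have h0 : ∀ U : IndexSets N, 0 ≤ ∏ u ∈ U.1, σ u := fun U => Finset.prod_nonneg fun u _ => hσ u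
  constructor
  · intro h
    obtain ⟨U, hU⟩ : ∃ U : IndexSets N, ∏ u ∈ U.1, σ u ≠ 0 := by
      by_contra! h'
      simp [h'] at h
    obtain ⟨u, hu, hNu⟩ : ∃ u ∈ U.1, N ≤ u := by
      by_contra! h'
      have h1 : U.1 ⊆ Finset.Ico 1 N := fun u hu => Finset.mem_Ico.mpr ⟨one_le, h' u hu⟩
      have h2 := Finset.card_le_card h1
      rw [U.2, PNat.card_Ico] at h2
      have := N.pos
      simp at h2
      omega
    exact lt_of_lt_of_le (lt_of_le_of_ne (hσ u) (Finset.prod_ne_zero_iff.mp hU u hu).symm)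
      (hanti hNu)
  · intro h
    refine (summable_prod_indexSets hσ hsum N).tsum_pos h0
      ⟨Finset.Icc 1 N, by simp [PNat.card_Icc]⟩ (Finset.prod_pos fun u hu => ?_)
    exact h.trans_le (hanti (Finset.mem_Icc.mp hu).2)

end EigenvalueSums

end VolumeSampling


theorem mainTheorem5 {X : Type*} [TopologicalSpace X] [MeasurableSpace X] [BorelSpace X]
    (ω : Measure X) [SigmaFinite ω] [ω.IsOpenPosMeasure]
    (k : X → X → ℝ) (hk_cont : Continuous (Function.uncurry k))
    (hk_pos : (Matrix.of k).PosSemidef)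
    (hk_int : Integrable (fun x => k x x) ω)
    (σ : ℕ+ → ℝ) (e : ℕ+ → X → ℝ) (he : VolumeSampling.IsEigensystem k ω σ e)
    (N : ℕ+) :
    -- each mixture component (a projection DPP) is a probability density
    (∀ U : VolumeSampling.IndexSets N,
      VolumeSampling.IsDensity ω (fun x : Fin N → X =>
        ((N : ℕ).factorial : ℝ)⁻¹ *
          VolumeSampling.kernelDet (VolumeSampling.projectionKernel e U.1) x)) ∧
    -- the unnormalized density is the mixture, at every configuration
    (∀ x : Fin N → X,
      HasSum (fun U : VolumeSampling.IndexSets N =>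
          (∏ u ∈ U.1, σ u) *
            VolumeSampling.kernelDet (VolumeSampling.projectionKernel e U.1) x)
        (VolumeSampling.kernelDet k x)) ∧
    -- the normalization constant
    Integrable (fun x : Fin N → X => VolumeSampling.kernelDet k x)
      (VolumeSampling.configMeasure ω N) ∧
    Summable (fun U : VolumeSampling.IndexSets N => ∏ u ∈ U.1, σ u) ∧
    VolumeSampling.normalizationConstant k ω N =
      ((N : ℕ).factorial : ℝ) * ∑' U : VolumeSampling.IndexSets N, ∏ u ∈ U.1, σ u ∧
    -- the volume-sampling density exists as soon as the `N`-th eigenvalue is positive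
    (0 < VolumeSampling.normalizationConstant k ω N ↔ 0 < σ N) ∧
    (0 < σ N →
      VolumeSampling.IsDensity ω (VolumeSampling.vsDensity k ω N) ∧
      ∀ x : Fin N → X,
        VolumeSampling.vsDensity k ω N x =
          (VolumeSampling.normalizationConstant k ω N)⁻¹ *
            ∑' U : VolumeSampling.IndexSets N,
              (∏ u ∈ U.1, σ u) *
                VolumeSampling.kernelDet (VolumeSampling.projectionKernel e U.1) x) := by
  obtain ⟨hσ, hmercer⟩ := VolumeSampling.hasSum_kernel hk_cont hk_pos hk_int he
  have hσsum : Summable σ := he.summable_eigenvalues hk_cont hk_pos hk_int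
  have hcomp := fun U : VolumeSampling.IndexSets N =>
    he.integral_kernelDet_projectionKernel U.2
  have hdet := fun x : Fin N → X => VolumeSampling.hasSum_kernelDet hσ hmercer x
  have hprod := VolumeSampling.summable_prod_indexSets hσ hσsum N
  have hfact : ((N : ℕ).factorial : ℝ) ≠ 0 := by positivity
  have hterm : ∀ U : VolumeSampling.IndexSets N,
      ∫ x : Fin N → X, (∏ u ∈ U.1, σ u) *
        VolumeSampling.kernelDet (VolumeSampling.projectionKernel e U.1) x
          ∂(VolumeSampling.configMeasure ω N) =
        ((N : ℕ).factorial : ℝ) * ∏ u ∈ U.1, σ u := fun U => by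
    rw [integral_const_mul, (hcomp U).2, mul_comm]
  have hterm0 : ∀ (U : VolumeSampling.IndexSets N) (x : Fin N → X), 0 ≤ (∏ u ∈ U.1, σ u) *
      VolumeSampling.kernelDet (VolumeSampling.projectionKernel e U.1) x := fun U x =>
    mul_nonneg (Finset.prod_nonneg fun u _ => hσ u)
      (VolumeSampling.kernelDet_projectionKernel_nonneg e U.2 x)
  obtain ⟨hint, hZsum⟩ := VolumeSampling.integrable_and_hasSum_integral hterm0
    (fun U => (hcomp U).1.const_mul _) (by simpa only [hterm] using hprod.mul_left _) hdet
  have hZ : VolumeSampling.normalizationConstant k ω N =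
      ((N : ℕ).factorial : ℝ) * ∑' U : VolumeSampling.IndexSets N, ∏ u ∈ U.1, σ u := by
    simp only [hterm] at hZsum
    exact hZsum.unique (hprod.hasSum.mul_left _)
  have hZpos : 0 < VolumeSampling.normalizationConstant k ω N ↔ 0 < σ N := by
    rw [hZ, mul_pos_iff_of_pos_left (by positivity)]
    exact VolumeSampling.tsum_prod_indexSets_pos_iff hσ he.antitone hσsum N
  refine ⟨fun U => ⟨fun x => ?_, (hcomp U).1.const_mul _, ?_⟩, hdet, hint, hprod, hZ, hZpos,
    fun hN => ⟨⟨fun x => ?_, hint.const_mul _, ?_⟩, fun x => ?_⟩⟩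
  · exact mul_nonneg (by positivity) (VolumeSampling.kernelDet_projectionKernel_nonneg e U.2 x)
  · rw [integral_const_mul, (hcomp U).2, inv_mul_cancel₀ hfact]
  · exact mul_nonneg (inv_nonneg.mpr (hZpos.mpr hN).le) ((hdet x).nonneg fun U => hterm0 U x)
  · simp only [VolumeSampling.vsDensity]
    rw [integral_const_mul]
    exact inv_mul_cancel₀ (hZpos.mpr hN).ne'
  · rw [VolumeSampling.vsDensity, (hdet x).tsum_eq]
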